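/- Let $n\ge 1$, $N=n^2$, and identify $n\times n$ real images with vectors of $\mathbb R^N$, with the Euclidean norm $\|\cdot\|$ and pixel set $J=\{1,\dots,n\}^2$. With periodic boundary conditions (indices modulo $n$) let $(D_+^xu)_{i,j}=u_{i,j+1}-u_{i,j}$, $(D_-^xu)_{i,j}=u_{i,j}-u_{i,j-1}$, $(D_+^yu)_{i,j}=u_{i+1,j}-u_{i,j}$, $(D_-^yu)_{i,j}=u_{i,j}-u_{i-1,j}$. For $p\in J$ let $D_pu=((D_+^xu)_p,(D_+^yu)_p)\in\mathbb R^2$, and let $Hu=(D_-^xD_+^xu,\,D_+^xD_+^yu,\,D_+^yD_+^xu,\,D_-^yD_+^yu)\in\mathbb R^{4N}$. Let $\Omega_1(u)=\{p\in J:\|D_pu\|\ne 0\}$ and $\Omega_0(u)=J\setminus\Omega_1(u)$. Let $\phi:[0,\infty)\to[0,\infty)$ satisfy: (i) $\phi$ is continuous, concave and coercive ($\phi(t)\to\infty$ as $t\to\infty$), with $\phi(0)=0$; (ii) $\phi$ is $C^1$ on $(0,\infty)$ with $\phi'>0$ there and $\phi'(t)\to+\infty$ as $t\downarrow 0$; (iii)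 for every $c>0$, $\phi'$ is Lipschitz continuous on $[c,\infty)$. Let $f\in\mathbb R^N$, $\alpha,\beta,\gamma,\rho>0$, and $$F(u,v)=\tfrac12\|f-u-v\|^2+\alpha\sum_{p\in J}\phi(\|D_pu\|)+\tfrac\beta2\|Hv\|^2+\tfrac\gamma2\|v\|^2,\qquad (u,v)\in\mathbb R^N\times\mathbb R^N.$$ For $\sigma:\mathbb R^d\to\mathbb R$, the regular subdifferential $\widehat\partial\sigma(x)$ is the set of $w$ with $\liminf_{y\to x,\,y\ne x}\frac{\sigma(y)-\sigma(x)-\langle w,y-x\rangle}{\|y-x\|}\ge 0$; the limiting subdifferential $\partial\sigma(x)$ is the set of limits of sequences $w^k\in\widehat\partial\sigma(x^k)$ with $x^k\to x$ and $\sigma(x^k)\to\sigma(x)$. The function $\sigma$ is a KL function if for each $\bar x$ with $\partial\sigma(\bar x)\ne\emptyset$ there are $\eta\in(0,\infty]$, a neighborhood $U$ of $\bar x$, and a continuous concave $\psi:[0,\eta)\to[0,\infty)$ with $\psi(0)=0$ that is $C^1$ on $(0,\eta)$ with $\psi'>0$ there, such that $\psi'(\sigma(x)-\sigma(\bar x))\,\mathrm{dist}(0,\partial\sigma(x))\ge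 1$ for all $x\in U$ with $\sigma(\bar x)<\sigma(x)<\sigma(\bar x)+\eta$ (where $\mathrm{dist}(0,\emptyset)=+\infty$). Let $(u^k,v^k)_{k\ge0}$ be generated by the algorithm ISSAPL-ID: $(u^0,v^0)=(f,f)$ and, for each $k\ge 0$, $(u^{k+1},v^{k+1})$ is an exact solution of $$\min_{u,v}\ \tfrac12\|f-u-v\|^2+\alpha\sum_{p\in\Omega_1(u^k)}\phi'(\|D_pu^k\|)\,\|D_pu\|+\tfrac\rho2\|u-u^k\|^2+\tfrac\beta2\|Hv\|^2+\tfrac\gamma2\|v\|^2\quad\text{subject to } D_pu=0\ \ \forall p\in\Omega_0(u^k).$$ Suppose that $F$ is a KL function. Then the whole sequence $(u^k,v^k)$ converges to a point $(u^*,v^*)$, and $(u^*,v^*)$ is a critical point of $F$, i.e. $0\in\partial F(u^*,v^*)$. -/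

import Mathlib

open Filter Topology

noncomputable section

namespace ImageDecomp

/-! ## Nonsmooth analysis -/

section Variational

variable {E : Type*} [NormedAddCommGroup E] [InnerProductSpace ℝ E]

/-- The regular (Fréchet) subdifferential of a finite-valued function `σ` at `x`: all `w` such that
the lower limit of `(σ y - σ x - ⟪w, y - x⟫) / ‖y - x‖`, as `y → x` with `y ≠ x`, is nonnegative.
The lower limit is taken in the extended reals. -/
def regularSubdiff (σ : E → ℝ) (x : E) : Set E :=
  {w | (0 : EReal) ≤
    liminf (fun y => (((σ y - σ x - inner ℝ w (y - x)) / ‖y - x‖ : ℝ) : EReal)) (𝓝[≠] x)}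

/-- The limiting subdifferential of a finite-valued function `σ` at `x`. -/
def limitingSubdiff (σ : E → ℝ) (x : E) : Set E :=
  {w | ∃ (y : ℕ → E) (g : ℕ → E),
    Tendsto y atTop (𝓝 x) ∧ Tendsto (fun k => σ (y k)) atTop (𝓝 (σ x)) ∧
    (∀ k, g k ∈ regularSubdiff σ (y k)) ∧ Tendsto g atTop (𝓝 w)}

/-- `x` is a critical point of `σ`. -/
def IsCriticalPoint (σ : E → ℝ) (x : E) : Prop :=
  (0 : E) ∈ limitingSubdiff σ x

/-- The Kurdyka–Łojasiewicz property of `σ` at `x`. The radius `η ∈ (0, ∞]` is extended-valued, and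
the distance from `0` to the subdifferential is `∞` when the subdifferential is empty. -/
def HasKLPropertyAt (σ : E → ℝ) (x : E) : Prop :=
  ∃ (η : EReal) (U : Set E) (ψ : ℝ → ℝ), 0 < η ∧ U ∈ 𝓝 x ∧
    (∀ s : ℝ, 0 ≤ s → (s : EReal) < η → 0 ≤ ψ s) ∧
    ContinuousOn ψ {s : ℝ | 0 ≤ s ∧ (s : EReal) < η} ∧
    ConcaveOn ℝ {s : ℝ | 0 ≤ s ∧ (s : EReal) < η} ψ ∧
    ψ 0 = 0 ∧
    ContDiffOn ℝ 1 ψ {s : ℝ | 0 < s ∧ (s : EReal) < η} ∧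
    (∀ s : ℝ, 0 < s → (s : EReal) < η → 0 < deriv ψ s) ∧
    ∀ y ∈ U, σ x < σ y → (σ y : EReal) < (σ x : EReal) + η →
      1 ≤ ENNReal.ofReal (deriv ψ (σ y - σ x)) * Metric.infEDist 0 (limitingSubdiff σ y)

/-- `σ` is a KL function: it has the KL property at every point of the domain of its limiting
subdifferential. -/
def IsKLFunction (σ : E → ℝ) : Prop :=
  ∀ x, (limitingSubdiff σ x).Nonempty → HasKLPropertyAt σ x

end Variational

/-! ## Images and difference operators -/

/-- Pixels `(i, j)` of an `n × n` image (row `i`, column `j`). -/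
abbrev Pixel (n : ℕ) := Fin n × Fin n

/-- Grayscale `n × n` images with the Euclidean norm. -/
abbrev Img (n : ℕ) := EuclideanSpace ℝ (Pixel n)

/-- Pairs `(u, v)` of images, with the Euclidean norm of `ℝ^N × ℝ^N`. -/
abbrev ImgPair (n : ℕ) := WithLp 2 (Img n × Img n)

/-- The pair `(u, v)`. -/
def mkPair {n : ℕ} (u v : Img n) : ImgPair n := WithLp.toLp 2 (u, v)

section Operators

variable {n : ℕ} [NeZero n]

/-- Horizontal forward difference; addition in `Fin n` is cyclic, which gives the periodic boundary
conditions. -/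
def Dxp : Img n →ₗ[ℝ] Img n where
  toFun u := WithLp.toLp 2 fun p => u (p.1, p.2 + 1) - u p
  map_add' u w := by ext p; simp; ring
  map_smul' c u := by ext p; simp; ring

/-- Horizontal backward difference. -/
def Dxm : Img n →ₗ[ℝ] Img n where
  toFun u := WithLp.toLp 2 fun p => u p - u (p.1, p.2 - 1)
  map_add' u w := by ext p; simp; ring
  map_smul' c u := by ext p; simp; ring

/-- Vertical forward difference. -/
def Dyp : Img n →ₗ[ℝ] Img n where
  toFun u := WithLp.toLp 2 fun p => u (p.1 + 1, p.2) - u p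
  map_add' u w := by ext p; simp; ring
  map_smul' c u := by ext p; simp; ring

/-- Vertical backward difference. -/
def Dym : Img n →ₗ[ℝ] Img n where
  toFun u := WithLp.toLp 2 fun p => u p - u (p.1 - 1, p.2)
  map_add' u w := by ext p; simp; ring
  map_smul' c u := by ext p; simp; ring

/-- The discrete gradient `D_p u ∈ ℝ²` of `u` at the pixel `p`. -/
def grad (p : Pixel n) : Img n →ₗ[ℝ] EuclideanSpace ℝ (Fin 2) where
  toFun u := !₂[Dxp u p, Dyp u p]
  map_add' u w := by ext a; fin_cases a <;> simp
  map_smul' c u := by ext a; fin_cases a <;> simp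

/-- The discrete Hessian `H u ∈ ℝ^{4N}`. -/
def hess : Img n →ₗ[ℝ] EuclideanSpace ℝ (Fin 4 × Pixel n) where
  toFun u := WithLp.toLp 2 fun q =>
    (![Dxm (Dxp u), Dxp (Dyp u), Dyp (Dxp u), Dym (Dyp u)] q.1 : Img n) q.2
  map_add' u w := by ext ⟨a, p⟩; fin_cases a <;> simp
  map_smul' c u := by ext ⟨a, p⟩; fin_cases a <;> simp

/-- The support `Ω₁(u)` of the discrete gradient of `u`. The complement is `Ω₀(u)`. -/
def gradSupport (u : Img n) : Finset (Pixel n) :=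
  Finset.univ.filter fun p => ‖grad p u‖ ≠ 0

end Operators

/-! ## The model and the algorithm -/

/-- The standing assumptions on the potential `φ : [0, ∞) → [0, ∞)`. Only the values of `φ` on
`[0, ∞)` are used. -/
structure IsPotential (φ : ℝ → ℝ) : Prop where
  nonneg : ∀ t, 0 ≤ t → 0 ≤ φ t
  continuousOn : ContinuousOn φ (Set.Ici 0)
  concaveOn : ConcaveOn ℝ (Set.Ici 0) φ
  coercive : Tendsto φ atTop atTop
  map_zero : φ 0 = 0
  contDiffOn : ContDiffOn ℝ 1 φ (Set.Ioi 0)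
  deriv_pos : ∀ t, 0 < t → 0 < deriv φ t
  deriv_zero : Tendsto (deriv φ) (𝓝[>] 0) atTop
  deriv_lipschitz : ∀ c, 0 < c → ∃ L : ℝ, ∀ x y, c ≤ x → c ≤ y →
    |deriv φ x - deriv φ y| ≤ L * |x - y|

variable {n : ℕ} [NeZero n]

/-- The objective `F(u, v)` of the decomposition model. -/
def objective (φ : ℝ → ℝ) (f : Img n) (α β γ : ℝ) (z : ImgPair n) : ℝ :=
  1 / 2 * ‖f - z.fst - z.snd‖ ^ 2 + α * ∑ p, φ ‖grad p z.fst‖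
    + β / 2 * ‖hess z.snd‖ ^ 2 + γ / 2 * ‖z.snd‖ ^ 2

/-- The objective `G_k(u, v)` of the proximal linearized subproblem at the current iterate
`u^k = uk`. -/
def subObjective (φ : ℝ → ℝ) (f : Img n) (α β γ ρ : ℝ) (uk : Img n) (z : ImgPair n) : ℝ :=
  1 / 2 * ‖f - z.fst - z.snd‖ ^ 2
    + α * ∑ p ∈ gradSupport uk, deriv φ ‖grad p uk‖ * ‖grad p z.fst‖
    + ρ / 2 * ‖z.fst - uk‖ ^ 2 + β / 2 * ‖hess z.snd‖ ^ 2 + γ / 2 * ‖z.snd‖ ^ 2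

/-- The feasible set of the subproblem: `D_p u = 0` wherever `D_p u^k = 0`. -/
def subFeasible (uk : Img n) : Set (ImgPair n) :=
  {z | ∀ p, p ∉ gradSupport uk → grad p z.fst = 0}

/-- `(u^k, v^k)` is generated by the iterative support shrinking algorithm with proximal
linearization: it starts at `(f, f)`, and each iterate solves the subproblem exactly. -/
structure IsISSAPLSequence (φ : ℝ → ℝ) (f : Img n) (α β γ ρ : ℝ) (u v : ℕ → Img n) : Prop where
  init_u : u 0 = f
  init_v : v 0 = f
  feasible : ∀ k, mkPair (u (k + 1)) (v (k + 1)) ∈ subFeasible (u k)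
  minimal : ∀ k, IsMinOn (subObjective φ f α β γ ρ (u k)) (subFeasible (u k))
    (mkPair (u (k + 1)) (v (k + 1)))

end ImageDecomp

end

open Filter Topology

noncomputable section

namespace ImageDecomp

/-! Feasibility makes the gradient supports of the iterates nested, hence constant from some index
on. The tail of the sequence is then analysed as a descent method for a KL function, which needs
three ingredients.

Sufficient decrease (`objective_add_le`): by concavity the linearized penalty majorizes the
increments of `φ`, while the proximal term controls the step in `u` and the strongly convex `γ`-term
controls the step in `v`.

Relative error (`exists_regularSubdiff_norm_le`): optimality of the subproblem is used only along
directions that preserve the zero gradients. This suffices because the infinite slope of `φ` at the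
origin absorbs every remaining linear error (`mem_regularSubdiff_objective`). Replacing the old
weights by the new ones costs a Lipschitz estimate for `φ'`, valid only away from 0. So the nonzero
gradients must be bounded below (`exists_le_norm_of_fixed_support`): were they to approach 0, the
weights would blow up and violate the optimality condition.

Boundedness comes from the data-fit and `γ` terms and yields a cluster point. It is critical by the
error bound, and the KL inequality makes the whole sequence converge to it
(`tendsto_of_hasKLPropertyAt`). -/

theorem concaveOn_le_tangent {s : Set ℝ} {g : ℝ → ℝ} (hg : ConcaveOn ℝ s g) {x y : ℝ}
    (hx : x ∈ s) (hy : y ∈ s) (hd : DifferentiableAt ℝ g x) :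
    g y ≤ g x + deriv g x * (y - x) := by
  rcases lt_trichotomy x y with h | h | h
  · have := hg.slope_le_of_hasDerivAt hx hy h hd.hasDerivAt
    rw [slope_def_field, div_le_iff₀ (by linarith)] at this
    linarith
  · simp [h]
  · have := hg.le_slope_of_hasDerivAt hy hx h hd.hasDerivAt
    rw [slope_def_field, le_div_iff₀ (by linarith)] at this
    linarith

/-! ### Concave potentials with infinite slope at the origin. -/

namespace IsPotential

variable {φ : ℝ → ℝ}

theorem differentiableAt (hφ : IsPotential φ) {t : ℝ} (ht : 0 < t) : DifferentiableAt ℝ φ t :=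
  (hφ.contDiffOn.differentiableOn (by simp)).differentiableAt (Ioi_mem_nhds ht)

theorem continuousAt_deriv (hφ : IsPotential φ) {t : ℝ} (ht : 0 < t) : ContinuousAt (deriv φ) t :=
  (hφ.contDiffOn.continuousOn_deriv_of_isOpen isOpen_Ioi (by simp)).continuousAt (Ioi_mem_nhds ht)

theorem le_tangent (hφ : IsPotential φ) {s t : ℝ} (hs : 0 < s) (ht : 0 ≤ t) :
    φ t ≤ φ s + deriv φ s * (t - s) :=
  concaveOn_le_tangent hφ.concaveOn hs.le ht (hφ.differentiableAt hs)

/-- The infinite slope at the origin: `φ` dominates every linear function near `0`. -/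
theorem exists_linear_le (hφ : IsPotential φ) (M : ℝ) :
    ∃ δ > 0, ∀ t, 0 ≤ t → t < δ → M * t ≤ φ t := by
  have h := hφ.deriv_zero.eventually_ge_atTop M
  obtain ⟨δ, hδ, h⟩ := mem_nhdsGT_iff_exists_Ioo_subset.1 h
  refine ⟨δ, hδ, fun t ht htδ => ?_⟩
  rcases ht.eq_or_lt with rfl | ht
  · simp [hφ.map_zero]
  · have h1 : M ≤ deriv φ t := h ⟨ht, htδ⟩
    have h2 := hφ.le_tangent ht le_rfl
    rw [hφ.map_zero] at h2
    nlinarith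

end IsPotential

/-! ### Subgradients and the abstract KL convergence argument. -/

section Variational

variable {E : Type*} [NormedAddCommGroup E] [InnerProductSpace ℝ E]

theorem mem_regularSubdiff_of_eventually {σ : E → ℝ} {x w : E}
    (h : ∀ ε > 0, ∀ᶠ y in 𝓝 x, -(ε * ‖y - x‖) ≤ σ y - σ x - inner ℝ w (y - x)) :
    w ∈ regularSubdiff σ x := by
  refine EReal.ge_of_forall_gt_iff_ge.1 fun r hr => ?_
  have hr' : r < 0 := by exact_mod_cast hr
  refine le_liminf_of_le (by isBoundedDefault) ?_
  filter_upwards [(h (-r) (by linarith)).filter_mono nhdsWithin_le_nhds, self_mem_nhdsWithin]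
    with y hy hne
  have hpos : 0 < ‖y - x‖ := norm_pos_iff.2 (sub_ne_zero.2 hne)
  rw [EReal.coe_le_coe_iff, le_div_iff₀ hpos]
  linarith

theorem regularSubdiff_subset_limitingSubdiff (σ : E → ℝ) (x : E) :
    regularSubdiff σ x ⊆ limitingSubdiff σ x := fun w hw =>
  ⟨fun _ => x, fun _ => w, tendsto_const_nhds, tendsto_const_nhds, fun _ => hw, tendsto_const_nhds⟩

/-- The squares are dominated by consecutive differences of a convergent sequence. -/
theorem tendsto_zero_of_mul_sq_le_sub {a ℓ : ℝ} (ha : 0 < a) {d r : ℕ → ℝ} (hd : ∀ k, 0 ≤ d k)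
    (hr : Tendsto r atTop (𝓝 ℓ)) (h : ∀ k, a * d k ^ 2 ≤ r k - r (k + 1)) :
    Tendsto d atTop (𝓝 0) := by
  have h1 : Tendsto (fun k => a⁻¹ * (r k - r (k + 1))) atTop (𝓝 0) := by
    simpa using (hr.sub (hr.comp (tendsto_add_atTop_nat 1))).const_mul a⁻¹
  have h2 : Tendsto (fun k => d k ^ 2) atTop (𝓝 0) := by
    refine squeeze_zero (fun k => sq_nonneg _) (fun k => ?_) h1
    rw [inv_mul_eq_div, le_div_iff₀ ha]
    linarith [h k]
  simpa [Real.sqrt_sq, hd] using h2.sqrt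

/-- A sequence with sufficient decrease and a relative error bound on its subgradients converges to
any of its cluster points at which the objective has the KL property. -/
theorem tendsto_of_hasKLPropertyAt {σ : E → ℝ} {x : E} (hσ : Continuous σ)
    (hKL : HasKLPropertyAt σ x) {a b : ℝ} (ha : 0 < a) (hb : 0 < b) {z : ℕ → E}
    (hdec : ∀ k, σ (z (k + 1)) + a * ‖z (k + 1) - z k‖ ^ 2 ≤ σ (z k))
    (hsub : ∀ k, ∃ w ∈ limitingSubdiff σ (z (k + 1)), ‖w‖ ≤ b * ‖z (k + 1) - z k‖)
    {s : ℕ → ℕ} (hs : StrictMono s) (hx : Tendsto (z ∘ s) atTop (𝓝 x)) :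
    Tendsto z atTop (𝓝 x) := by
  have hanti : Antitone (fun k => σ (z k)) :=
    antitone_nat_of_succ_le fun k => by nlinarith [hdec k, sq_nonneg ‖z (k + 1) - z k‖]
  have hsubσ : Tendsto (fun j => σ (z (s j))) atTop (𝓝 (σ x)) := (hσ.tendsto x).comp hx
  have hge : ∀ k, σ x ≤ σ (z k) := fun k => by
    refine le_of_tendsto hsubσ ?_
    filter_upwards [eventually_ge_atTop k] with j hj
    exact hanti (hj.trans (hs.id_le j))
  have hlim : Tendsto (fun k => σ (z k)) atTop (𝓝 (σ x)) := by
    refine Metric.tendsto_atTop.2 fun ε hε => ?_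
    obtain ⟨j, hj⟩ := ((Metric.tendsto_atTop.1 hsubσ) ε hε)
    refine ⟨s j, fun k hk => ?_⟩
    have h1 := hj j le_rfl
    rw [Real.dist_eq, abs_of_nonneg (by linarith [hge (s j)])] at h1
    rw [Real.dist_eq, abs_of_nonneg (by linarith [hge k])]
    linarith [hanti hk]
  -- The KL inequality says nothing at the limiting value itself. If that value is attained, the
  -- decrease condition freezes the sequence from there on.
  by_cases hzero : ∃ m, σ (z m) = σ x
  · obtain ⟨m, hm⟩ := hzero
    have hval : ∀ k, m ≤ k → σ (z k) = σ x := fun k hk =>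
      le_antisymm (hm ▸ hanti hk) (hge k)
    have hconst : ∀ k, m ≤ k → z k = z m := fun k hk => by
      induction k, hk using Nat.le_induction with
      | base => rfl
      | succ k hk ih =>
        have h1 := hdec k
        rw [hval k hk, hval (k + 1) (by omega)] at h1
        have h2 : ‖z (k + 1) - z k‖ ^ 2 ≤ 0 := by nlinarith
        have h3 : ‖z (k + 1) - z k‖ = 0 := by
          nlinarith [sq_nonneg ‖z (k + 1) - z k‖, norm_nonneg (z (k + 1) - z k)]
        rw [← ih]
        exact sub_eq_zero.1 (norm_eq_zero.1 h3)
    have hxm : x = z m := by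
      refine tendsto_nhds_unique hx (tendsto_const_nhds.congr' ?_)
      filter_upwards [eventually_ge_atTop m] with j hj
      exact (hconst _ (hj.trans (hs.id_le j))).symm
    rw [hxm]
    exact tendsto_const_nhds.congr' (by
      filter_upwards [eventually_ge_atTop m] with k hk using (hconst k hk).symm)
  have hgt : ∀ k, σ x < σ (z k) := fun k =>
    lt_of_le_of_ne (hge k) fun h => hzero ⟨k, h.symm⟩
  obtain ⟨η, U, ψ, hη, hU, hψ0, hψc, hψconc, hψz, hψd, hψpos, hψKL⟩ := hKL
  -- `η` may be infinite, so a real threshold below it is fixed.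
  obtain ⟨η₀, hη₀, hη₀'⟩ := EReal.lt_iff_exists_real_btwn.1 hη
  have hη₀pos : 0 < η₀ := by exact_mod_cast hη₀
  have hlt : ∀ t : ℝ, t < η₀ → (t : EReal) < η := fun t ht =>
    lt_trans (by exact_mod_cast ht) hη₀'
  set r : ℕ → ℝ := fun k => σ (z k) - σ x with hr
  have hrpos : ∀ k, 0 < r k := fun k => sub_pos.2 (hgt k)
  have hranti : ∀ k, r (k + 1) ≤ r k := fun k => by
    simpa [hr] using hanti (Nat.le_succ k)
  have hrlim : Tendsto r atTop (𝓝 0) := by simpa [hr] using hlim.sub_const (σ x)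
  have hrη : ∀ᶠ k in atTop, r k < η₀ := hrlim.eventually_lt_const hη₀pos
  have hψr : Tendsto (fun k => ψ (r k)) atTop (𝓝 0) := by
    have h0 := hψc 0 ⟨le_rfl, by exact_mod_cast hη⟩
    rw [ContinuousWithinAt, hψz] at h0
    refine h0.comp (tendsto_nhdsWithin_iff.2 ⟨hrlim, ?_⟩)
    filter_upwards [hrη] with k hk using ⟨(hrpos k).le, hlt _ hk⟩
  set d : ℕ → ℝ := fun k => ‖z (k + 1) - z k‖ with hd
  have hdlim : Tendsto d atTop (𝓝 0) :=
    tendsto_zero_of_mul_sq_le_sub ha (fun k => norm_nonneg _) hrlim fun k => by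
      have := hdec k
      simp only [hr, hd]
      linarith
  have hdiff : ∀ t : ℝ, 0 < t → t < η₀ → DifferentiableAt ℝ ψ t := fun t ht htη =>
    (hψd.differentiableOn (by simp)).differentiableAt (by
      filter_upwards [Ioo_mem_nhds ht htη] with y hy using ⟨hy.1, hlt _ hy.2⟩)
  -- Write `D` for the slope of `ψ` at `r (k + 1)` and `P` for the decrease of `ψ`. KL and the error
  -- bound give `1 ≤ D * (b * d k)`; concavity and the decrease give `D * (a * d (k + 1) ^ 2) ≤ P`.
  -- Multiplying eliminates `D`, and the arithmetic-geometric mean inequality linearizes the result.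
  have hstep : ∀ k, r (k + 1) < η₀ → z (k + 1) ∈ U →
      2 * d (k + 1) ≤ d k + b / a * (ψ (r (k + 1)) - ψ (r (k + 2))) := by
    intro k hrk hzU
    obtain ⟨w, hw, hwb⟩ := hsub k
    have h1 := hψKL _ hzU (hgt _) (by
      have h := hlt _ hrk
      have : (σ (z (k + 1)) : EReal) = (σ x : EReal) + ((r (k + 1) : ℝ) : EReal) := by
        rw [← EReal.coe_add]; congr 1; simp only [hr]; ring
      rw [this]
      exact EReal.add_lt_add_left_coe h _)
    have hψ' := hψpos _ (hrpos (k + 1)) (hlt _ hrk)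
    have h2 : 1 ≤ deriv ψ (r (k + 1)) * ‖w‖ := by
      have h3 : (1 : ENNReal) ≤ ENNReal.ofReal (deriv ψ (r (k + 1)) * ‖w‖) := by
        rw [ENNReal.ofReal_mul hψ'.le, ofReal_norm, ← edist_zero_right,
          edist_comm]
        exact h1.trans (by gcongr; exact Metric.infEDist_le_edist_of_mem hw)
      exact ENNReal.one_le_ofReal.1 h3
    have h4 := concaveOn_le_tangent hψconc (x := r (k + 1)) (y := r (k + 2))
      ⟨(hrpos _).le, hlt _ hrk⟩
      ⟨(hrpos _).le, hlt _ ((hranti (k + 1)).trans_lt hrk)⟩ (hdiff _ (hrpos _) hrk)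
    have h5 : a * d (k + 1) ^ 2 ≤ r (k + 1) - r (k + 2) := by
      have := hdec (k + 1)
      simp only [hr, hd]; linarith
    set D := deriv ψ (r (k + 1))
    set P := ψ (r (k + 1)) - ψ (r (k + 2)) with hP
    have h6 : D * (a * d (k + 1) ^ 2) ≤ P := by
      have := mul_le_mul_of_nonneg_left h5 hψ'.le
      nlinarith
    have h7 : 1 ≤ D * (b * d k) := h2.trans (by gcongr)
    have hd0 : 0 ≤ d k := norm_nonneg _
    have hd1 : 0 ≤ d (k + 1) := norm_nonneg _
    have h8 : d (k + 1) ^ 2 ≤ d k * (b / a * P) := by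
      have e1 : a * d (k + 1) ^ 2 ≤ (b * d k) * P := by
        calc a * d (k + 1) ^ 2 ≤ (D * (b * d k)) * (a * d (k + 1) ^ 2) :=
              le_mul_of_one_le_left (by positivity) h7
          _ = (b * d k) * (D * (a * d (k + 1) ^ 2)) := by ring
          _ ≤ (b * d k) * P := by gcongr
      have e2 : d k * (b / a * P) = (b * d k) * P / a := by ring
      rw [e2, le_div_iff₀ ha]
      linarith
    have hP0 : 0 ≤ P := le_trans (by positivity) h6
    have hY : 0 ≤ b / a * P := by positivity
    refine (abs_le_of_sq_le_sq' ?_ (by positivity)).2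
    nlinarith [sq_nonneg (d k - b / a * P)]
  refine Metric.tendsto_atTop.2 fun ε hε => ?_
  obtain ⟨δ, hδ, hδU⟩ := Metric.mem_nhds_iff.1 hU
  set e := min ε δ with he
  have hepos : 0 < e := lt_min hε hδ
  -- One copy of `d` pays for the move to the next iterate, the other is the step term of the
  -- invariant in `hsum`.
  have hsmall : Tendsto (fun j => ‖z (s (j + 1)) - x‖ + d (s (j + 1)) + d (s (j + 1)) +
      b / a * ψ (r (s (j + 1)))) atTop (𝓝 0) := by
    have hs' : Tendsto (fun j => s (j + 1)) atTop atTop :=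
      hs.tendsto_atTop.comp (tendsto_add_atTop_nat 1)
    have h1 : Tendsto (fun j => ‖z (s (j + 1)) - x‖) atTop (𝓝 0) :=
      tendsto_iff_norm_sub_tendsto_zero.1 (hx.comp (tendsto_add_atTop_nat 1))
    simpa using ((h1.add (hdlim.comp hs')).add (hdlim.comp hs')).add
      ((hψr.comp hs').const_mul (b / a))
  obtain ⟨j, hj1, hj2⟩ := ((hsmall.eventually_lt_const hepos).and
    ((hs.tendsto_atTop.comp (tendsto_add_atTop_nat 1)).eventually hrη)).exists
  set m := s (j + 1) with hm
  have hrm : ∀ i, r (m + i) < η₀ := fun i => by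
    have : r (m + i) ≤ r m := by
      induction i with
      | zero => rfl
      | succ i ih => exact (hranti _).trans ih
    exact this.trans_lt hj2
  have hba : 0 < b / a := div_pos hb ha
  have hψn : ∀ i, 0 ≤ ψ (r (m + i)) := fun i => hψ0 _ (hrpos _).le (hlt _ (hrm i))
  -- The left side is a Lyapunov quantity: `hstep` and the triangle inequality make it nonincreasing
  -- as long as the iterate lies in `U`, and its being below `e ≤ δ` keeps the iterate there. No
  -- summation of step lengths is needed.
  have hsum : ∀ i, ‖z (m + 1 + i) - x‖ + d (m + i) + b / a * ψ (r (m + 1 + i)) < e := by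
    intro i
    induction i with
    | zero =>
      have h1 : ‖z (m + 1) - x‖ ≤ d m + ‖z m - x‖ := by
        have := norm_add_le (z (m + 1) - z m) (z m - x)
        rwa [sub_add_sub_cancel] at this
      have h2 : ψ (r (m + 1)) ≤ ψ (r m) := by
        have h3 := concaveOn_le_tangent hψconc (x := r m) (y := r (m + 1))
          ⟨(hrpos _).le, hlt _ (hrm 0)⟩ ⟨(hrpos _).le, hlt _ (hrm 1)⟩ (hdiff _ (hrpos _) (hrm 0))
        have h5 := mul_nonneg (hψpos (r m) (hrpos _) (hlt _ (hrm 0))).le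
          (sub_nonneg.2 (hranti m))
        linarith
      have h4 : b / a * ψ (r (m + 1)) ≤ b / a * ψ (r m) := by gcongr
      simp only [add_zero]
      linarith
    | succ i ih =>
      have hzU : z (m + i + 1) ∈ U := hδU (by
        rw [Metric.mem_ball, dist_eq_norm, add_right_comm]
        have : 0 ≤ b / a * ψ (r (m + 1 + i)) := mul_nonneg hba.le (by
          rw [add_assoc]; exact hψn _)
        have := norm_nonneg (z (m + i + 1) - z (m + i))
        have := min_le_right ε δ
        simp only [hd] at ih
        linarith)
      have h1 := hstep (m + i) (hrm (i + 1)) hzU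
      have h2 : ‖z (m + i + 2) - x‖ ≤ d (m + i + 1) + ‖z (m + i + 1) - x‖ := by
        have := norm_add_le (z (m + i + 2) - z (m + i + 1)) (z (m + i + 1) - x)
        rwa [sub_add_sub_cancel] at this
      rw [show m + 1 + (i + 1) = m + i + 2 by ring, show m + (i + 1) = m + i + 1 by ring]
      rw [show m + 1 + i = m + i + 1 by ring] at ih
      linarith
  refine ⟨m + 1, fun k hk => ?_⟩
  obtain ⟨i, rfl⟩ := Nat.exists_eq_add_of_le hk
  have h1 : 0 ≤ b / a * ψ (r (m + 1 + i)) := mul_nonneg hba.le (by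
    rw [add_assoc]; exact hψn _)
  have h2 := norm_nonneg (z (m + i + 1) - z (m + i))
  have h3 := hsum i
  have h4 := min_le_left ε δ
  rw [dist_eq_norm]
  simp only [hd] at h3
  linarith

end Variational

/-! ### Finite-dimensional linear algebra, and the descent theorem for bounded sequences. -/

section Linear

variable {E X : Type*} [NormedAddCommGroup E] [InnerProductSpace ℝ E] [FiniteDimensional ℝ E]
  [NormedAddCommGroup X] [NormedSpace ℝ X] {ι : Type*}

/-- A vector can be corrected, inside its class modulo the common kernel of the maps `A p`,
`p ∈ S`, to one that is controlled by its images under these maps. -/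
theorem exists_norm_le_sum_of_eq (A : ι → E →L[ℝ] X) (S : Finset ι) :
    ∃ C, 0 ≤ C ∧ ∀ h, ∃ h', (∀ p ∈ S, A p h' = A p h) ∧ ‖h'‖ ≤ C * ∑ p ∈ S, ‖A p h‖ := by
  let T : E →ₗ[ℝ] (S → X) := LinearMap.pi fun p => (A p.1 : E →ₗ[ℝ] X)
  -- A linear section of the joint map onto its range; it is bounded because the range is
  -- finite-dimensional.
  obtain ⟨R, hR⟩ := T.rangeRestrict.exists_rightInverse_of_surjective T.range_rangeRestrict
  let R' := LinearMap.toContinuousLinearMap R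
  refine ⟨‖R'‖, R'.opNorm_nonneg, fun h => ⟨R (T.rangeRestrict h), fun p hp => ?_, ?_⟩⟩
  · have h1 : T.rangeRestrict (R (T.rangeRestrict h)) = T.rangeRestrict h :=
      LinearMap.congr_fun hR _
    have h2 : T (R (T.rangeRestrict h)) = T h := congrArg Subtype.val h1
    exact congrFun h2 ⟨p, hp⟩
  · refine (R'.le_opNorm _).trans (mul_le_mul_of_nonneg_left ?_ R'.opNorm_nonneg)
    refine (pi_norm_le_iff_of_nonneg (Finset.sum_nonneg fun _ _ => norm_nonneg _)).2 fun p => ?_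
    exact Finset.single_le_sum (f := fun p => ‖A p h‖) (fun _ _ => norm_nonneg _) p.2

theorem exists_inner_eq_of_abs_le (Λ : E →L[ℝ] ℝ) {B : ℝ} (hB : 0 ≤ B)
    (h : ∀ x, |Λ x| ≤ B * ‖x‖) : ∃ w : E, (∀ x, inner ℝ w x = Λ x) ∧ ‖w‖ ≤ B := by
  refine ⟨(InnerProductSpace.toDual ℝ E).symm Λ, fun x => by simp, ?_⟩
  rw [LinearIsometryEquiv.norm_map]
  exact Λ.opNorm_le_bound hB h

end Linear

/-- Convergence of bounded descent sequences of KL functions to critical points. -/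
theorem exists_tendsto_isCriticalPoint_of_isKLFunction {E : Type*} [NormedAddCommGroup E]
    [InnerProductSpace ℝ E] [FiniteDimensional ℝ E] {σ : E → ℝ} (hσ : Continuous σ)
    (hKL : IsKLFunction σ) (hnonneg : ∀ x, 0 ≤ σ x) {a b R : ℝ} (ha : 0 < a) (hb : 0 < b)
    {z : ℕ → E} (hR : ∀ k, ‖z k‖ ≤ R)
    (hdec : ∀ k, σ (z (k + 1)) + a * ‖z (k + 1) - z k‖ ^ 2 ≤ σ (z k))
    (hsub : ∀ k, ∃ w ∈ regularSubdiff σ (z (k + 1)), ‖w‖ ≤ b * ‖z (k + 1) - z k‖) :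
    ∃ x, Tendsto z atTop (𝓝 x) ∧ IsCriticalPoint σ x := by
  have hanti : Antitone fun k => σ (z k) := antitone_nat_of_succ_le fun k =>
    (le_add_of_nonneg_right (by positivity)).trans (hdec k)
  have hstep : Tendsto (fun k => ‖z (k + 1) - z k‖) atTop (𝓝 0) := by
    have hlim := tendsto_atTop_ciInf hanti ⟨0, by
      rintro _ ⟨k, rfl⟩
      exact hnonneg _⟩
    exact tendsto_zero_of_mul_sq_le_sub ha (fun k => norm_nonneg _) hlim fun k => by
      linarith [hdec k]
  obtain ⟨x, -, s, hs, hx⟩ := tendsto_subseq_of_bounded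
    (s := Metric.closedBall (0 : E) R) Metric.isBounded_closedBall (x := z)
    fun k => by simpa using hR k
  choose w hw hwn using hsub
  -- Criticality comes first: it makes the subdifferential at `x` nonempty, as the KL hypothesis
  -- requires.
  have hcrit : IsCriticalPoint σ x := by
    have h1 : Tendsto (fun j => z (s j + 1)) atTop (𝓝 x) := by
      have h2 := (tendsto_zero_iff_norm_tendsto_zero.2 hstep).comp hs.tendsto_atTop
      simpa [Function.comp_def] using h2.add hx
    refine ⟨fun j => z (s j + 1), fun j => w (s j), h1, (hσ.tendsto x).comp h1,
      fun j => hw (s j), squeeze_zero_norm (fun j => hwn (s j)) ?_⟩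
    simpa using (hstep.comp hs.tendsto_atTop).const_mul b
  exact ⟨x, tendsto_of_hasKLPropertyAt hσ (hKL x ⟨0, hcrit⟩) ha hb hdec
    (fun k => ⟨w k, regularSubdiff_subset_limitingSubdiff σ _ (hw k), hwn k⟩) hs hx, hcrit⟩

/-! ### Uniform lower bound on the nonzero gradients. -/

section LowerBound

variable {E X : Type*} [NormedAddCommGroup E] [InnerProductSpace ℝ E] [FiniteDimensional ℝ E]
  [NormedAddCommGroup X] [InnerProductSpace ℝ X] {ι : Type*} [Fintype ι]

/-- If the supports of `p ↦ A p (x k)` do not depend on `k` and the linearized penalty is bounded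
on the directions that keep the support, then the nonzero values stay away from zero: the
blow-up of `φ'` at `0` is incompatible with small nonzero values. -/
theorem exists_le_norm_of_fixed_support {φ : ℝ → ℝ} (hφ : IsPotential φ) (A : ι → E →L[ℝ] X)
    (Ω : Finset ι) {x : ℕ → E} {R B : ℝ} (hR : ∀ k, ‖x k‖ ≤ R)
    (hΩ : ∀ k p, A p (x k) ≠ 0 ↔ p ∈ Ω)
    (hB : ∀ k h, (∀ p ∉ Ω, A p h = 0) →
      |∑ p ∈ Ω, deriv φ ‖A p (x k)‖ *
        (‖A p (x (k + 1))‖⁻¹ * inner ℝ (A p (x (k + 1))) (A p h))| ≤ B * ‖h‖) :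
    ∃ c > 0, ∀ k, ∀ p ∈ Ω, c ≤ ‖A p (x k)‖ := by
  classical
  suffices H : ∀ p ∈ Ω, ∃ c > 0, ∀ k, c ≤ ‖A p (x k)‖ by
    have H' : ∀ p : ι, ∀ᶠ c : ℝ in 𝓝[>] 0, p ∈ Ω → ∀ k, c ≤ ‖A p (x k)‖ := fun p => by
      by_cases hp : p ∈ Ω
      · obtain ⟨c, hc, h⟩ := H p hp
        filter_upwards [Ioo_mem_nhdsGT hc] with t ht _ k using ht.2.le.trans (h k)
      · exact Eventually.of_forall fun _ h => absurd h hp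
    obtain ⟨c, hc, hc0⟩ := ((eventually_all.2 H').and self_mem_nhdsWithin).exists
    exact ⟨c, hc0, fun k p hp => hc p hp k⟩
  intro q hq
  by_contra! hcon
  -- The indices `s j` need not increase; only a cluster point `y` of the selected vectors is used.
  choose s hs using fun j : ℕ => hcon (1 / ((j : ℝ) + 1)) (by positivity)
  obtain ⟨y, -, t, ht, hy⟩ := tendsto_subseq_of_bounded (s := Metric.closedBall (0 : E) R)
    Metric.isBounded_closedBall (x := fun j => x (s j)) (fun j => by simpa using hR (s j))
  have hA : ∀ p, Tendsto (fun j => ‖A p (x (s (t j)))‖) atTop (𝓝 ‖A p y‖) := fun p =>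
    (((A p).continuous.tendsto y).comp hy).norm
  have hqy : A q y = 0 := by
    have h1 : Tendsto (fun j => ‖A q (x (s (t j)))‖) atTop (𝓝 0) :=
      squeeze_zero (fun _ => norm_nonneg _) (fun j => (hs (t j)).le)
        (tendsto_one_div_add_atTop_nhds_zero_nat.comp ht.tendsto_atTop)
    exact norm_eq_zero.1 (tendsto_nhds_unique (hA q) h1)
  set S := Ω.filter fun p => A p y = 0 with hS
  set P := Ω.filter fun p => ¬ A p y = 0 with hP
  -- The test direction `h` will copy `x (k + 1)` off `P`: it vanishes outside `Ω`, matches `x (k +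
  -- 1)` on `S`, and has norm at most `C` times the total size `σ` on `S`. Nearness of `x (k + 1)`
  -- to `y` is never needed; only the weights are evaluated at `x k`.
  obtain ⟨C, hC0, hC⟩ := exists_norm_le_sum_of_eq A (Finset.univ \ P)
  let D := ∑ p ∈ P, (deriv φ ‖A p y‖ + 1) * ‖A p‖
  -- Large weights on `S` will force `M * σ ≤ (|B| + D) * C * σ`; the extra 1 contradicts `σ > 0`.
  let M := (|B| + D) * C + 1
  have hbdd : ∀ᶠ j in atTop, ∀ p ∈ P, deriv φ ‖A p (x (s (t j)))‖ < deriv φ ‖A p y‖ + 1 :=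
    (Finset.eventually_all P).2 fun p hp =>
      ((hφ.continuousAt_deriv (norm_pos_iff.2 (Finset.mem_filter.1 hp).2)).tendsto.comp
        (hA p)).eventually_lt_const (by linarith)
  have hlarge : ∀ᶠ j in atTop, ∀ p ∈ S, M ≤ deriv φ ‖A p (x (s (t j)))‖ := by
    refine (Finset.eventually_all S).2 fun p hp => ?_
    obtain ⟨hpΩ, hpy⟩ := Finset.mem_filter.1 hp
    have h1 := hA p
    rw [hpy, norm_zero] at h1
    refine (hφ.deriv_zero.comp (tendsto_nhdsWithin_iff.2 ⟨h1, ?_⟩)).eventually_ge_atTop M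
    exact Eventually.of_forall fun j => norm_pos_iff.2 ((hΩ _ p).2 hpΩ)
  obtain ⟨j, hj1, hj2⟩ := (hbdd.and hlarge).exists
  set k := s (t j) with hk
  set σ := ∑ p ∈ S, ‖A p (x (k + 1))‖ with hσ
  obtain ⟨h, hh, hhn⟩ := hC (x (k + 1))
  have hzero : ∀ p ∉ Ω, A p (x (k + 1)) = 0 := fun p hp => by
    by_contra hne
    exact hp ((hΩ _ p).1 hne)
  have hsumσ : ∑ p ∈ Finset.univ \ P, ‖A p (x (k + 1))‖ = σ := by
    symm
    refine Finset.sum_subset (fun p hp => ?_) fun p hp hpS => ?_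
    · simp [hP, (Finset.mem_filter.1 hp).2]
    · rw [hzero p fun hpΩ => ?_, norm_zero]
      simp only [hP, hS, Finset.mem_sdiff, Finset.mem_univ, true_and, Finset.mem_filter] at hp hpS
      tauto
  rw [hsumσ] at hhn
  have hσpos : 0 < σ := Finset.sum_pos'
    (fun _ _ => norm_nonneg _) ⟨q, Finset.mem_filter.2 ⟨hq, hqy⟩, norm_pos_iff.2 ((hΩ _ q).2 hq)⟩
  have hmain := hB k h fun p hp => by
    rw [hh p (by simp [hP, hp]), hzero p hp]
  rw [← Finset.sum_filter_add_sum_filter_not Ω (fun p => A p y = 0)] at hmain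
  have hSsum : M * σ ≤ ∑ p ∈ S, deriv φ ‖A p (x k)‖ *
      (‖A p (x (k + 1))‖⁻¹ * inner ℝ (A p (x (k + 1))) (A p h)) := by
    rw [hσ, Finset.mul_sum]
    refine Finset.sum_le_sum fun p hp => ?_
    obtain ⟨hpΩ, hpy⟩ := Finset.mem_filter.1 hp
    have hpos : 0 < ‖A p (x (k + 1))‖ := norm_pos_iff.2 ((hΩ _ p).2 hpΩ)
    rw [hh p (by simp [hP, hpy]), real_inner_self_eq_norm_sq, pow_two, inv_mul_cancel_left₀ hpos.ne']
    exact mul_le_mul_of_nonneg_right (hj2 p hp) hpos.le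
  have hPsum : |∑ p ∈ P, deriv φ ‖A p (x k)‖ *
      (‖A p (x (k + 1))‖⁻¹ * inner ℝ (A p (x (k + 1))) (A p h))| ≤ D * ‖h‖ := by
    refine (Finset.abs_sum_le_sum_abs _ _).trans ?_
    rw [Finset.sum_mul]
    refine Finset.sum_le_sum fun p hp => ?_
    have hpΩ := (Finset.mem_filter.1 hp).1
    have hpos : 0 < ‖A p (x (k + 1))‖ := norm_pos_iff.2 ((hΩ _ p).2 hpΩ)
    have hd := hφ.deriv_pos _ (norm_pos_iff.2 ((hΩ k p).2 hpΩ))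
    rw [abs_mul, abs_of_pos hd, abs_mul, abs_of_pos (inv_pos.2 hpos), mul_assoc]
    refine mul_le_mul (hj1 p hp).le ?_ (by positivity) (hd.le.trans (hj1 p hp).le)
    rw [inv_mul_le_iff₀ hpos]
    exact (abs_real_inner_le_norm _ _).trans (by gcongr; exact (A p).le_opNorm h)
  have h1 : M * σ ≤ (|B| + D) * ‖h‖ := by
    have h2 := (abs_le.1 hmain).2
    have h3 := (abs_le.1 hPsum).1
    have h4 := mul_le_mul_of_nonneg_right (le_abs_self B) (norm_nonneg h)
    linarith
  have hD : 0 ≤ D := Finset.sum_nonneg fun p hp =>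
    mul_nonneg (by
      have := hφ.deriv_pos _ (norm_pos_iff.2 (Finset.mem_filter.1 hp).2)
      linarith) (norm_nonneg _)
  have h2 : (|B| + D) * ‖h‖ ≤ (|B| + D) * (C * σ) :=
    mul_le_mul_of_nonneg_left hhn (by positivity)
  have h3 : M * σ = (|B| + D) * (C * σ) + σ := by simp only [M]; ring
  linarith

end LowerBound

/-! ### Differentiability, optimality and descent for the decomposition model. -/

section Model

variable {n : ℕ} [NeZero n]

/-- The discrete gradient of the first component of a pair of images. -/
def gradFst (p : Pixel n) : ImgPair n →L[ℝ] EuclideanSpace ℝ (Fin 2) :=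
  LinearMap.toContinuousLinearMap (grad p) ∘L WithLp.fstL 2 ℝ (Img n) (Img n)

@[simp]
theorem gradFst_apply (p : Pixel n) (z : ImgPair n) : gradFst p z = grad p z.fst := rfl

/-- The discrete Hessian of the second component of a pair of images. -/
def hessSnd : ImgPair n →L[ℝ] EuclideanSpace ℝ (Fin 4 × Pixel n) :=
  LinearMap.toContinuousLinearMap hess ∘L WithLp.sndL 2 ℝ (Img n) (Img n)

@[simp]
theorem hessSnd_apply (z : ImgPair n) : hessSnd z = hess z.snd := rfl

@[simp]
theorem mem_gradSupport {u : Img n} {p : Pixel n} : p ∈ gradSupport u ↔ grad p u ≠ 0 := by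
  simp [gradSupport]

/-- The quadratic part of the objective. -/
def quadPart (f : Img n) (β γ : ℝ) (z : ImgPair n) : ℝ :=
  1 / 2 * ‖f - z.fst - z.snd‖ ^ 2 + β / 2 * ‖hess z.snd‖ ^ 2 + γ / 2 * ‖z.snd‖ ^ 2

/-- The derivative of the quadratic part of the objective. -/
def quadDeriv (f : Img n) (β γ : ℝ) (z : ImgPair n) : ImgPair n →L[ℝ] ℝ :=
  innerSL ℝ (z.fst + z.snd - f) ∘L
      (WithLp.fstL 2 ℝ (Img n) (Img n) + WithLp.sndL 2 ℝ (Img n) (Img n)) +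
    β • innerSL ℝ (hess z.snd) ∘L hessSnd +
    γ • innerSL ℝ z.snd ∘L WithLp.sndL 2 ℝ (Img n) (Img n)

theorem hasFDerivAt_quadPart (f : Img n) (β γ : ℝ) (z : ImgPair n) :
    HasFDerivAt (quadPart f β γ) (quadDeriv f β γ z) z := by
  have h1 := ((((WithLp.fstL 2 ℝ (Img n) (Img n)).hasFDerivAt (x := z)).const_sub f).sub
    ((WithLp.sndL 2 ℝ (Img n) (Img n)).hasFDerivAt (x := z))).norm_sq.const_mul (1 / 2)
  have h2 := ((hessSnd (n := n)).hasFDerivAt (x := z)).norm_sq.const_mul (β / 2)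
  have h3 := ((WithLp.sndL 2 ℝ (Img n) (Img n)).hasFDerivAt (x := z)).norm_sq.const_mul (γ / 2)
  refine ((h1.add h2).add h3).congr_fderiv ?_
  ext h
  simp [quadDeriv]
  ring

theorem continuous_quadDeriv (f : Img n) (β γ : ℝ) : Continuous (quadDeriv f β γ) := by
  have h1 : Continuous fun z : ImgPair n => z.fst := (WithLp.fstL 2 ℝ (Img n) (Img n)).continuous
  have h2 : Continuous fun z : ImgPair n => z.snd := (WithLp.sndL 2 ℝ (Img n) (Img n)).continuous
  have h3 : Continuous fun z : ImgPair n => hess z.snd := (hessSnd (n := n)).continuous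
  unfold quadDeriv
  fun_prop

/-- The derivative of `z ↦ ‖D_p z.fst‖`, where this gradient does not vanish. -/
def normDeriv (p : Pixel n) (z : ImgPair n) : ImgPair n →L[ℝ] ℝ :=
  ‖gradFst p z‖⁻¹ • innerSL ℝ (gradFst p z) ∘L gradFst p

theorem normDeriv_apply (p : Pixel n) (z h : ImgPair n) :
    normDeriv p z h = ‖gradFst p z‖⁻¹ * inner ℝ (gradFst p z) (gradFst p h) := rfl

theorem abs_normDeriv_le (p : Pixel n) (z h : ImgPair n) :
    |normDeriv p z h| ≤ ‖gradFst p h‖ := by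
  rw [normDeriv_apply, abs_mul, abs_of_nonneg (inv_nonneg.2 (norm_nonneg _))]
  refine inv_mul_le_of_le_mul₀ (norm_nonneg _) (norm_nonneg _) (abs_real_inner_le_norm _ _)

theorem hasFDerivAt_norm_gradFst {p : Pixel n} {z : ImgPair n} (hz : grad p z.fst ≠ 0) :
    HasFDerivAt (fun y => ‖gradFst p y‖) (normDeriv p z) z := by
  have hpos : 0 < ‖gradFst p z‖ := norm_pos_iff.2 hz
  have h1 := ((gradFst p).hasFDerivAt (x := z)).norm_sq.sqrt (by positivity)
  simp only [Real.sqrt_sq (norm_nonneg _)] at h1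
  refine h1.congr_fderiv ?_
  ext h
  simp only [normDeriv, smul_apply, smul_eq_mul, nsmul_eq_mul,
    ContinuousLinearMap.comp_apply]
  simp
  field_simp

theorem objective_eq (φ : ℝ → ℝ) (f : Img n) (α β γ : ℝ) (z : ImgPair n) :
    objective φ f α β γ z = quadPart f β γ z + α * ∑ p, φ ‖grad p z.fst‖ := by
  simp only [objective, quadPart]
  ring

theorem subObjective_eq (φ : ℝ → ℝ) (f : Img n) (α β γ ρ : ℝ) (uk : Img n) (z : ImgPair n) :
    subObjective φ f α β γ ρ uk z = quadPart f β γ z +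
      α * ∑ p ∈ gradSupport uk, deriv φ ‖grad p uk‖ * ‖grad p z.fst‖ +
      ρ / 2 * ‖z.fst - uk‖ ^ 2 := by
  simp only [subObjective, quadPart]
  ring

theorem continuous_objective {φ : ℝ → ℝ} (hφ : IsPotential φ) (f : Img n) (α β γ : ℝ) :
    Continuous (objective φ f α β γ) := by
  have h1 : Continuous (quadPart f β γ) := by
    have hu : Continuous fun z : ImgPair n => z.fst := (WithLp.fstL 2 ℝ (Img n) (Img n)).continuous
    have hv : Continuous fun z : ImgPair n => z.snd := (WithLp.sndL 2 ℝ (Img n) (Img n)).continuous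
    have hh : Continuous fun z : ImgPair n => hess z.snd := (hessSnd (n := n)).continuous
    unfold quadPart
    fun_prop
  have h2 : ∀ p : Pixel n, Continuous fun z : ImgPair n => φ ‖gradFst p z‖ := fun p =>
    hφ.continuousOn.comp_continuous (gradFst p).continuous.norm fun z =>
      Set.mem_Ici.2 (norm_nonneg (gradFst p z))
  rw [funext (objective_eq φ f α β γ)]
  exact h1.add (continuous_const.mul (continuous_finsetSum _ fun p _ => h2 p))

/-- A vector that represents the derivative of the smooth part of the objective on the directions
preserving the vanishing gradients is a regular subgradient. -/
theorem mem_regularSubdiff_objective {φ : ℝ → ℝ} (hφ : IsPotential φ) {f : Img n} {α β γ : ℝ}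
    (hα : 0 < α) {z w : ImgPair n}
    (hw : ∀ h, (∀ p ∉ gradSupport z.fst, gradFst p h = 0) →
      inner ℝ w h = quadDeriv f β γ z h +
        α * ∑ p ∈ gradSupport z.fst, deriv φ ‖grad p z.fst‖ * normDeriv p z h) :
    w ∈ regularSubdiff (objective φ f α β γ) z := by
  set Ω := gradSupport z.fst with hΩ
  let S : ImgPair n → ℝ := fun y => quadPart f β γ y + α * ∑ p ∈ Ω, φ ‖gradFst p y‖
  let S' : ImgPair n →L[ℝ] ℝ := quadDeriv f β γ z +
    α • ∑ p ∈ Ω, deriv φ ‖gradFst p z‖ • normDeriv p z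
  have hS : HasFDerivAt S S' z := by
    refine (hasFDerivAt_quadPart f β γ z).add (HasFDerivAt.const_mul ?_ α)
    refine HasFDerivAt.fun_sum fun p hp => ?_
    have hp' := mem_gradSupport.1 hp
    exact (hφ.differentiableAt (norm_pos_iff.2 hp')).hasDerivAt.comp_hasFDerivAt z
      (hasFDerivAt_norm_gradFst hp')
  have hsplit : ∀ y, objective φ f α β γ y = S y + α * ∑ p ∈ Ωᶜ, φ ‖gradFst p y‖ := fun y => by
    rw [objective_eq, ← Finset.sum_add_sum_compl Ω]
    simp only [S, gradFst_apply]
    ring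
  have hvan : ∀ p ∈ Ωᶜ, gradFst p z = 0 := fun p hp => by
    simpa [hΩ] using hp
  have hz : objective φ f α β γ z = S z := by
    rw [hsplit, Finset.sum_eq_zero fun p hp => by rw [hvan p hp, norm_zero, hφ.map_zero]]
    simp
  obtain ⟨C, hC0, hC⟩ := exists_norm_le_sum_of_eq (gradFst (n := n)) Ωᶜ
  -- `N` vanishes on support-preserving directions, so `N (y - z)` depends only on the gradients
  -- outside `Ω` and is bounded by `‖N‖ * C` times their sum. Near 0, `φ` exceeds the line of slope
  -- `‖N‖ * C / α`, which absorbs this error.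
  let N := S' - innerSL ℝ w
  obtain ⟨δ, hδ, hφδ⟩ := hφ.exists_linear_le (‖N‖ * C / α)
  refine mem_regularSubdiff_of_eventually fun ε hε => ?_
  have hnear : ∀ᶠ y in 𝓝 z, ∀ p ∈ Ωᶜ, ‖gradFst p y‖ < δ :=
    (Finset.eventually_all Ωᶜ).2 fun p hp => by
      have h1 := ((gradFst p).continuous.norm.tendsto z)
      rw [hvan p hp, norm_zero] at h1
      exact h1.eventually_lt_const hδ
  filter_upwards [hS.isLittleO.def hε, hnear] with y hy hyδ
  obtain ⟨h, hh, hhn⟩ := hC (y - z)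
  have hAy : ∀ p ∈ Ωᶜ, gradFst p (y - z) = gradFst p y := fun p hp => by
    rw [map_sub, hvan p hp, sub_zero]
  have h1 : N (y - z) = N h := by
    have h2 := hw (y - z - h) fun p hp => by
      rw [map_sub, hh p (Finset.mem_compl.2 hp), sub_self]
    have h3 : N (y - z - h) = 0 := by
      simp only [N, S', sub_apply, innerSL_apply_apply, h2]
      simp
    rw [map_sub, sub_eq_zero] at h3
    exact h3
  have h2 : |N h| ≤ α * ∑ p ∈ Ωᶜ, φ ‖gradFst p y‖ := by
    calc |N h| ≤ ‖N‖ * ‖h‖ := N.le_opNorm h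
      _ ≤ ‖N‖ * (C * ∑ p ∈ Ωᶜ, ‖gradFst p (y - z)‖) := by gcongr
      _ = α * ∑ p ∈ Ωᶜ, ‖N‖ * C / α * ‖gradFst p y‖ := by
        rw [Finset.sum_congr rfl fun p hp => by rw [hAy p hp], ← Finset.mul_sum]
        field_simp
      _ ≤ _ := by
        gcongr with p hp
        exact hφδ _ (norm_nonneg _) (hyδ p hp)
  rw [Real.norm_eq_abs] at hy
  have h3 := (abs_le.1 hy).1
  have h4 := (abs_le.1 h2).1
  have h5 : N (y - z) = S' (y - z) - inner ℝ w (y - z) := by simp [N]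
  rw [hsplit y, hz]
  linarith

theorem gradSupport_subset_of_mem_subFeasible {uk : Img n} {z : ImgPair n}
    (hz : z ∈ subFeasible uk) : gradSupport z.fst ⊆ gradSupport uk := fun p hp => by
  by_contra h
  exact mem_gradSupport.1 hp (hz p h)

/-- First-order optimality of a solution of the subproblem, along the directions that preserve its
vanishing gradients. -/
theorem subObjective_first_order {φ : ℝ → ℝ} {f uk : Img n} {α β γ ρ : ℝ} {z : ImgPair n}
    (hz : z ∈ subFeasible uk) (hmin : IsMinOn (subObjective φ f α β γ ρ uk) (subFeasible uk) z)
    {h : ImgPair n} (hh : ∀ p ∉ gradSupport z.fst, gradFst p h = 0) :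
    quadDeriv f β γ z h +
      α * ∑ p ∈ gradSupport z.fst, deriv φ ‖grad p uk‖ * normDeriv p z h +
      ρ * inner ℝ (z.fst - uk) h.fst = 0 := by
  set Ω := gradSupport z.fst with hΩ
  let S : ImgPair n → ℝ := fun y => quadPart f β γ y +
    α * ∑ p ∈ Ω, deriv φ ‖grad p uk‖ * ‖gradFst p y‖ + ρ / 2 * ‖y.fst - uk‖ ^ 2
  let S' : ImgPair n →L[ℝ] ℝ := quadDeriv f β γ z +
    α • ∑ p ∈ Ω, deriv φ ‖grad p uk‖ • normDeriv p z +
    (ρ / 2) • (2 • innerSL ℝ (z.fst - uk) ∘L WithLp.fstL 2 ℝ (Img n) (Img n))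
  have hS : HasFDerivAt S S' z := by
    refine ((hasFDerivAt_quadPart f β γ z).add (HasFDerivAt.const_mul ?_ α)).add
      ((((WithLp.fstL 2 ℝ (Img n) (Img n)).hasFDerivAt (x := z)).sub_const uk).norm_sq.const_mul
        (ρ / 2))
    exact HasFDerivAt.fun_sum fun p hp =>
      (hasFDerivAt_norm_gradFst (mem_gradSupport.1 hp)).const_mul _
  have hvan : ∀ (t : ℝ), ∀ p ∉ Ω, gradFst p (z + t • h) = 0 := fun t p hp => by
    have h1 : gradFst p z = 0 := by simpa [hΩ] using hp
    rw [map_add, map_smul, h1, hh p hp]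
    simp
  have hsub := gradSupport_subset_of_mem_subFeasible hz
  -- The subproblem sums over the old support, but along this line the terms outside the new one are
  -- zero, which leaves a function differentiable at `z`.
  have hval : ∀ t : ℝ, subObjective φ f α β γ ρ uk (z + t • h) = S (z + t • h) := fun t => by
    rw [subObjective_eq, ← Finset.sum_subset hsub]
    · rfl
    · intro p _ hp
      rw [← gradFst_apply, hvan t p hp, norm_zero, mul_zero]
  have hloc : IsLocalMin (fun t : ℝ => S (z + t • h)) 0 := by
    refine Eventually.of_forall fun t => ?_
    have h1 := hmin (show z + t • h ∈ subFeasible uk from fun p hp => hvan t p fun h' => hp (hsub h'))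
    have h2 := hval 0
    simp only [zero_smul, add_zero, Set.mem_ofPred_eq] at h1 h2 ⊢
    rw [← h2, ← hval t]
    exact h1
  have h0 := hloc.hasDerivAt_eq_zero (hS.hasLineDerivAt h)
  rw [← h0]
  simp [S', inner_sub_left]
  ring

/-- The parallelogram law, used as exact strong convexity at a midpoint. -/
theorem norm_half_smul_add_sq {V : Type*} [NormedAddCommGroup V] [InnerProductSpace ℝ V]
    (a b : V) :
    ‖(1 / 2 : ℝ) • (a + b)‖ ^ 2 = 1 / 2 * ‖a‖ ^ 2 + 1 / 2 * ‖b‖ ^ 2 - 1 / 4 * ‖a - b‖ ^ 2 := by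
  have h := parallelogram_law_with_norm ℝ a b
  rw [norm_smul, mul_pow]
  norm_num
  nlinarith

/-- Sufficient decrease of the objective along a step of the algorithm. -/
theorem objective_add_le {φ : ℝ → ℝ} (hφ : IsPotential φ) {f : Img n} {α β γ ρ : ℝ}
    (hα : 0 < α) (hβ : 0 < β) {z z' : ImgPair n} (hz' : z' ∈ subFeasible z.fst)
    (hmin : IsMinOn (subObjective φ f α β γ ρ z.fst) (subFeasible z.fst) z') (hρ : 0 < ρ) :
    objective φ f α β γ z' + min ρ γ / 4 * ‖z' - z‖ ^ 2 ≤ objective φ f α β γ z := by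
  set Ω := gradSupport z.fst with hΩ
  -- Comparing with `z` itself would give no decrease in the second component. The midpoint does:
  -- doubling the resulting inequality leaves `3ρ/4` for the first component and `γ/4` for the
  -- second, whence the factor `min ρ γ / 4`.
  set y : ImgPair n := (1 / 2 : ℝ) • (z' + z) with hy
  have hzvan : ∀ p ∉ Ω, grad p z.fst = 0 := fun p hp => by simpa [hΩ] using hp
  have hyf : y.fst = (1 / 2 : ℝ) • (z'.fst + z.fst) := rfl
  have hys : y.snd = (1 / 2 : ℝ) • (z'.snd + z.snd) := rfl
  have hyfeas : y ∈ subFeasible z.fst := fun p hp => by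
    rw [hyf, map_smul, map_add, hz' p hp, hzvan p hp]
    simp
  have h1 : subObjective φ f α β γ ρ z.fst z' ≤ subObjective φ f α β γ ρ z.fst y := hmin hyfeas
  have e1 : ‖f - y.fst - y.snd‖ ^ 2 ≤
      1 / 2 * ‖f - z'.fst - z'.snd‖ ^ 2 + 1 / 2 * ‖f - z.fst - z.snd‖ ^ 2 := by
    have h2 := norm_half_smul_add_sq (f - z'.fst - z'.snd) (f - z.fst - z.snd)
    have h3 : f - y.fst - y.snd =
        (1 / 2 : ℝ) • ((f - z'.fst - z'.snd) + (f - z.fst - z.snd)) := by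
      rw [hyf, hys]
      module
    rw [h3, h2]
    nlinarith [sq_nonneg ‖(f - z'.fst - z'.snd) - (f - z.fst - z.snd)‖]
  have e2 : ‖hess y.snd‖ ^ 2 ≤ 1 / 2 * ‖hess z'.snd‖ ^ 2 + 1 / 2 * ‖hess z.snd‖ ^ 2 := by
    rw [hys, map_smul, map_add, norm_half_smul_add_sq]
    nlinarith [sq_nonneg ‖hess z'.snd - hess z.snd‖]
  have e3 : ‖y.snd‖ ^ 2 = 1 / 2 * ‖z'.snd‖ ^ 2 + 1 / 2 * ‖z.snd‖ ^ 2 -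
      1 / 4 * ‖z'.snd - z.snd‖ ^ 2 := by
    rw [hys, norm_half_smul_add_sq]
  have e4 : ‖y.fst - z.fst‖ ^ 2 = 1 / 4 * ‖z'.fst - z.fst‖ ^ 2 := by
    have h3 : y.fst - z.fst = (1 / 2 : ℝ) • (z'.fst - z.fst) := by
      rw [hyf]
      module
    rw [h3, norm_smul, mul_pow]
    norm_num
  have e5 : ∑ p ∈ Ω, deriv φ ‖grad p z.fst‖ * ‖grad p y.fst‖ ≤
      1 / 2 * ∑ p ∈ Ω, deriv φ ‖grad p z.fst‖ * ‖grad p z'.fst‖ +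
        1 / 2 * ∑ p ∈ Ω, deriv φ ‖grad p z.fst‖ * ‖grad p z.fst‖ := by
    rw [Finset.mul_sum, Finset.mul_sum, ← Finset.sum_add_distrib]
    refine Finset.sum_le_sum fun p hp => ?_
    have hd := hφ.deriv_pos _ (norm_pos_iff.2 (mem_gradSupport.1 hp))
    have h2 : ‖grad p y.fst‖ ≤ 1 / 2 * (‖grad p z'.fst‖ + ‖grad p z.fst‖) := by
      rw [hyf, map_smul, map_add, norm_smul]
      norm_num
      exact norm_add_le _ _
    nlinarith
  -- Outside `Ω` both gradients vanish, so these terms cancel; on `Ω` the tangent line lies above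
  -- `φ`.
  have e6 : ∑ p, φ ‖grad p z'.fst‖ - ∑ p, φ ‖grad p z.fst‖ ≤
      ∑ p ∈ Ω, deriv φ ‖grad p z.fst‖ * ‖grad p z'.fst‖ -
        ∑ p ∈ Ω, deriv φ ‖grad p z.fst‖ * ‖grad p z.fst‖ := by
    rw [← Finset.sum_sub_distrib, ← Finset.sum_sub_distrib,
      ← Finset.sum_subset (Finset.subset_univ Ω) fun p _ hp => by
        rw [hz' p hp, hzvan p hp, sub_self]]
    refine Finset.sum_le_sum fun p hp => ?_
    have h2 := hφ.le_tangent (norm_pos_iff.2 (mem_gradSupport.1 hp)) (norm_nonneg (grad p z'.fst))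
    linarith
  have e7 : ‖z' - z‖ ^ 2 = ‖z'.fst - z.fst‖ ^ 2 + ‖z'.snd - z.snd‖ ^ 2 :=
    WithLp.prod_norm_sq_eq_of_L2 _
  have e8 : min ρ γ * ‖z'.fst - z.fst‖ ^ 2 ≤ ρ * ‖z'.fst - z.fst‖ ^ 2 := by
    gcongr; exact min_le_left _ _
  have e9 : min ρ γ * ‖z'.snd - z.snd‖ ^ 2 ≤ γ * ‖z'.snd - z.snd‖ ^ 2 := by
    gcongr; exact min_le_right _ _
  have m2 := mul_le_mul_of_nonneg_left e2 hβ.le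
  have m5 := mul_le_mul_of_nonneg_left e5 hα.le
  have m6 := mul_le_mul_of_nonneg_left e6 hα.le
  have hρ' : 0 ≤ ρ * ‖z'.fst - z.fst‖ ^ 2 := by positivity
  simp only [subObjective, e3, e4] at h1
  simp only [objective, e7]
  rw [← hΩ] at h1
  linarith

end Model

/-! ### Boundedness, relative error and the final assembly. -/

section Convergence

variable {n : ℕ} [NeZero n]

theorem norm_fst_le {n : ℕ} (h : ImgPair n) : ‖h.fst‖ ≤ ‖h‖ := by
  refine (abs_le_of_sq_le_sq' ?_ (norm_nonneg _)).2
  rw [WithLp.prod_norm_sq_eq_of_L2 h]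
  nlinarith [sq_nonneg ‖h.snd‖]

theorem objective_nonneg {φ : ℝ → ℝ} (hφ : IsPotential φ) (f : Img n) {α β γ : ℝ} (hα : 0 ≤ α)
    (hβ : 0 ≤ β) (hγ : 0 ≤ γ) (z : ImgPair n) : 0 ≤ objective φ f α β γ z := by
  have h1 : 0 ≤ ∑ p, φ ‖grad p z.fst‖ :=
    Finset.sum_nonneg fun p _ => hφ.nonneg _ (norm_nonneg _)
  unfold objective
  positivity

/-- The sublevel sets of the objective are bounded. -/
theorem norm_le_of_objective_le {φ : ℝ → ℝ} (hφ : IsPotential φ) {f : Img n} {α β γ c : ℝ}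
    (hα : 0 ≤ α) (hβ : 0 ≤ β) (hγ : 0 < γ) {z : ImgPair n} (hz : objective φ f α β γ z ≤ c) :
    ‖z‖ ≤ ‖f‖ + √(2 * c) + 2 * √(2 * c / γ) := by
  have h1 : 0 ≤ ∑ p, φ ‖grad p z.fst‖ :=
    Finset.sum_nonneg fun p _ => hφ.nonneg _ (norm_nonneg _)
  have h2 : 0 ≤ α * ∑ p, φ ‖grad p z.fst‖ := by positivity
  have h3 : 0 ≤ β / 2 * ‖hess z.snd‖ ^ 2 := by positivity
  have h4 : 0 ≤ γ / 2 * ‖z.snd‖ ^ 2 := by positivity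
  have h5 : 0 ≤ ‖f - z.fst - z.snd‖ ^ 2 := by positivity
  unfold objective at hz
  have hv : ‖z.snd‖ ≤ √(2 * c / γ) := Real.le_sqrt_of_sq_le (by
    rw [le_div_iff₀ hγ]
    linarith)
  have hr : ‖f - z.fst - z.snd‖ ≤ √(2 * c) := Real.le_sqrt_of_sq_le (by linarith)
  have hu : ‖z.fst‖ ≤ ‖f‖ + ‖f - z.fst - z.snd‖ + ‖z.snd‖ := by
    have h6 : z.fst = f - (f - z.fst - z.snd) - z.snd := by abel
    calc ‖z.fst‖ = ‖f - (f - z.fst - z.snd) - z.snd‖ := congrArg _ h6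
      _ ≤ _ := (norm_sub_le _ _).trans (by gcongr; exact norm_sub_le _ _)
  have hz' : ‖z‖ ≤ ‖z.fst‖ + ‖z.snd‖ := by
    refine (abs_le_of_sq_le_sq' ?_ (by positivity)).2
    rw [WithLp.prod_norm_sq_eq_of_L2]
    nlinarith [norm_nonneg z.fst, norm_nonneg z.snd]
  linarith

/-- Relative error bound: a step of the algorithm that keeps the support, and along which the
nonzero gradients stay above `c`, produces a regular subgradient controlled by its length. -/
theorem exists_regularSubdiff_norm_le {φ : ℝ → ℝ} (hφ : IsPotential φ) {f : Img n}
    {α β γ ρ c L : ℝ} (hα : 0 < α) (hρ : 0 < ρ)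
    (hL : ∀ x y, c ≤ x → c ≤ y → |deriv φ x - deriv φ y| ≤ L * |x - y|) {z z' : ImgPair n}
    (hz' : z' ∈ subFeasible z.fst)
    (hmin : IsMinOn (subObjective φ f α β γ ρ z.fst) (subFeasible z.fst) z')
    (hc : ∀ p ∈ gradSupport z'.fst, c ≤ ‖grad p z.fst‖ ∧ c ≤ ‖grad p z'.fst‖) :
    ∃ w ∈ regularSubdiff (objective φ f α β γ) z',
      ‖w‖ ≤ (ρ + α * ∑ p : Pixel n, |L| * ‖gradFst p‖ ^ 2) * ‖z' - z‖ := by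
  set Ω := gradSupport z'.fst with hΩ
  -- What remains when the first-order identity of the subproblem is subtracted from the derivative
  -- of the smooth part of the objective at `z'`: the change of weights and the proximal term, both
  -- of the order of the step.
  let Λ : ImgPair n →L[ℝ] ℝ :=
    α • ∑ p ∈ Ω, (deriv φ ‖grad p z'.fst‖ - deriv φ ‖grad p z.fst‖) • normDeriv p z' -
      ρ • innerSL ℝ (z'.fst - z.fst) ∘L WithLp.fstL 2 ℝ (Img n) (Img n)
  have hΛ : ∀ h, Λ h = α * ∑ p ∈ Ω, (deriv φ ‖grad p z'.fst‖ - deriv φ ‖grad p z.fst‖) *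
      normDeriv p z' h - ρ * inner ℝ (z'.fst - z.fst) h.fst := fun h => by
    simp [Λ, inner_sub_left]
  obtain ⟨w, hw, hwn⟩ := exists_inner_eq_of_abs_le Λ
    (B := (ρ + α * ∑ p : Pixel n, |L| * ‖gradFst p‖ ^ 2) * ‖z' - z‖)
    (by have : 0 ≤ ∑ p : Pixel n, |L| * ‖gradFst p‖ ^ 2 :=
          Finset.sum_nonneg fun p _ => by positivity
        positivity) fun h => by
      have h1 : |∑ p ∈ Ω, (deriv φ ‖grad p z'.fst‖ - deriv φ ‖grad p z.fst‖) *
          normDeriv p z' h| ≤ (∑ p : Pixel n, |L| * ‖gradFst p‖ ^ 2) * (‖z' - z‖ * ‖h‖) := by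
        rw [Finset.sum_mul]
        refine (Finset.abs_sum_le_sum_abs _ _).trans ((Finset.sum_le_sum fun p hp => ?_).trans
          (Finset.sum_le_sum_of_subset_of_nonneg (Finset.subset_univ Ω)
            fun p _ _ => by positivity))
        have h2 : |deriv φ ‖grad p z'.fst‖ - deriv φ ‖grad p z.fst‖| ≤
            |L| * (‖gradFst p‖ * ‖z' - z‖) := by
          refine (hL _ _ (hc p hp).2 (hc p hp).1).trans
            (mul_le_mul (le_abs_self L) ?_ (abs_nonneg _) (abs_nonneg _))
          refine (abs_norm_sub_norm_le _ _).trans ?_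
          have h3 := (gradFst p).le_opNorm (z' - z)
          rwa [map_sub] at h3
        have h4 : |normDeriv p z' h| ≤ ‖gradFst p‖ * ‖h‖ :=
          (abs_normDeriv_le p z' h).trans ((gradFst p).le_opNorm h)
        rw [abs_mul]
        refine (mul_le_mul h2 h4 (abs_nonneg _) (by positivity)).trans_eq (by ring)
      have h5 : |inner ℝ (z'.fst - z.fst) h.fst| ≤ ‖z' - z‖ * ‖h‖ :=
        (abs_real_inner_le_norm _ _).trans (mul_le_mul (norm_fst_le (z' - z)) (norm_fst_le h)
          (norm_nonneg _) (norm_nonneg _))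
      rw [hΛ]
      refine (abs_sub _ _).trans ?_
      rw [abs_mul, abs_mul, abs_of_pos hα, abs_of_pos hρ]
      nlinarith
  refine ⟨w, mem_regularSubdiff_objective hφ hα fun h hh => ?_, hwn⟩
  have h1 := subObjective_first_order hz' hmin hh
  rw [hw, hΛ]
  simp only [sub_mul, Finset.sum_sub_distrib] at h1 ⊢
  rw [← hΩ] at h1 ⊢
  linarith

/-- The nested supports of the iterates are eventually constant. -/
theorem exists_gradSupport_eq {u : ℕ → Img n}
    (hu : ∀ k, gradSupport (u (k + 1)) ⊆ gradSupport (u k)) :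
    ∃ K, ∀ k, gradSupport (u (k + K)) = gradSupport (u K) := by
  obtain ⟨K, hK⟩ := WellFoundedLT.antitone_chain_condition
    (α := Finset (Pixel n)) (f := fun k => gradSupport (u k))
    (antitone_nat_of_succ_le hu)
  exact ⟨K, fun k => (hK (k + K) (Nat.le_add_left _ _)).symm⟩

/-- Bound of the linearized penalty along the directions that preserve the support, on a bounded
set of iterates. -/
theorem exists_abs_sum_le {φ : ℝ → ℝ} {f : Img n} {α β γ ρ : ℝ} (hα : 0 < α) (hρ : 0 < ρ)
    (R : ℝ) : ∃ B, ∀ z z' : ImgPair n, ‖z‖ ≤ R → ‖z'‖ ≤ R → z' ∈ subFeasible z.fst →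
      IsMinOn (subObjective φ f α β γ ρ z.fst) (subFeasible z.fst) z' →
      ∀ h, (∀ p ∉ gradSupport z'.fst, gradFst p h = 0) →
        |∑ p ∈ gradSupport z'.fst, deriv φ ‖grad p z.fst‖ * normDeriv p z' h| ≤ B * ‖h‖ := by
  -- First-order optimality expresses the penalty sum through the quadratic and proximal
  -- derivatives, which are bounded on the ball.
  obtain ⟨B, hB⟩ := (isCompact_closedBall (0 : ImgPair n) R).exists_bound_of_continuousOn
    (continuous_quadDeriv f β γ).continuousOn
  refine ⟨(B + ρ * (2 * R)) / α, fun z z' hz hz' hfeas hmin h hh => ?_⟩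
  have h1 := subObjective_first_order hfeas hmin hh
  have h2 : |quadDeriv f β γ z' h| ≤ B * ‖h‖ :=
    ((quadDeriv f β γ z').le_opNorm h).trans (by gcongr; exact hB z' (by simpa using hz'))
  have h3 : |inner ℝ (z'.fst - z.fst) h.fst| ≤ 2 * R * ‖h‖ := by
    refine (abs_real_inner_le_norm _ _).trans (mul_le_mul ?_ (norm_fst_le h) (norm_nonneg _) ?_)
    · refine (norm_fst_le (z' - z)).trans ((norm_sub_le _ _).trans (by linarith))
    · linarith [norm_nonneg z]
  rw [div_mul_eq_mul_div, le_div_iff₀ hα]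
  set s := ∑ p ∈ gradSupport z'.fst, deriv φ ‖grad p z.fst‖ * normDeriv p z' h
  have h4 : s * α = -(quadDeriv f β γ z' h) - ρ * inner ℝ (z'.fst - z.fst) h.fst := by linarith
  have h5 : |s| * α = |s * α| := by rw [abs_mul, abs_of_pos hα]
  rw [h5, h4]
  refine (abs_sub _ _).trans ?_
  rw [abs_neg, abs_mul, abs_of_pos hρ]
  nlinarith

/-- Global convergence of the algorithm to a critical point of the objective. -/
theorem IsISSAPLSequence.exists_tendsto_isCriticalPoint (φ : ℝ → ℝ) (hφ : IsPotential φ)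
    (f : Img n) (α β γ ρ : ℝ) (hα : 0 < α) (hβ : 0 < β) (hγ : 0 < γ) (hρ : 0 < ρ)
    (hKL : IsKLFunction (objective φ f α β γ))
    (u v : ℕ → Img n)
    (huv : IsISSAPLSequence φ f α β γ ρ u v) :
    ∃ ustar vstar : Img n,
      Tendsto (fun k => mkPair (u k) (v k)) atTop
        (𝓝 (mkPair ustar vstar)) ∧
      IsCriticalPoint (objective φ f α β γ)
        (mkPair ustar vstar) := by
  set F := objective φ f α β γ
  set a := min ρ γ / 4
  have hapos : 0 < a := div_pos (lt_min hρ hγ) (by norm_num)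
  have hmono : ∀ k, gradSupport (u (k + 1)) ⊆ gradSupport (u k) := fun k => by
    have h := gradSupport_subset_of_mem_subFeasible (huv.feasible k)
    exact h
  -- The first `K` iterates are discarded; the shift is undone at the end, since it does not affect
  -- the limit.
  obtain ⟨K, hK⟩ := exists_gradSupport_eq hmono
  set Ω := gradSupport (u K)
  set z : ℕ → ImgPair n := fun k => mkPair (u (k + K)) (v (k + K)) with hz
  have hsucc : ∀ k, z (k + 1) = mkPair (u (k + K + 1)) (v (k + K + 1)) := fun k => by
    simp only [hz, add_right_comm]
  have hfeas : ∀ k, z (k + 1) ∈ subFeasible (z k).fst := fun k => by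
    rw [hsucc]
    exact huv.feasible (k + K)
  have hmin : ∀ k, IsMinOn (subObjective φ f α β γ ρ (z k).fst) (subFeasible (z k).fst)
      (z (k + 1)) := fun k => by
    rw [hsucc]
    exact huv.minimal (k + K)
  have hsupp : ∀ k, gradSupport (z k).fst = Ω := hK
  have hdec : ∀ k, F (z (k + 1)) + a * ‖z (k + 1) - z k‖ ^ 2 ≤ F (z k) := fun k =>
    objective_add_le hφ hα hβ (hfeas k) (hmin k) hρ
  have hanti : Antitone fun k => F (z k) := antitone_nat_of_succ_le fun k =>
    (le_add_of_nonneg_right (by positivity)).trans (hdec k)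
  have hbdd : ∀ k, ‖z k‖ ≤ ‖f‖ + √(2 * F (z 0)) + 2 * √(2 * F (z 0) / γ) := fun k =>
    norm_le_of_objective_le hφ hα.le hβ.le hγ (hanti (Nat.zero_le k))
  set R := ‖f‖ + √(2 * F (z 0)) + 2 * √(2 * F (z 0) / γ)
  obtain ⟨B, hB⟩ := exists_abs_sum_le (φ := φ) (f := f) (β := β) (γ := γ) hα hρ R
  obtain ⟨c, hc, hlow⟩ := exists_le_norm_of_fixed_support hφ (gradFst (n := n)) Ω hbdd
    (fun k p => by rw [← hsupp k, mem_gradSupport, gradFst_apply]) fun k h hh => by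
      have h1 := hB (z k) (z (k + 1)) (hbdd k) (hbdd (k + 1)) (hfeas k) (hmin k) h
      rw [hsupp] at h1
      exact h1 hh
  obtain ⟨L, hL⟩ := hφ.deriv_lipschitz c hc
  set b := ρ + α * ∑ p : Pixel n, |L| * ‖gradFst p‖ ^ 2
  have hbpos : 0 < b := add_pos_of_pos_of_nonneg hρ
    (mul_nonneg hα.le (Finset.sum_nonneg fun p _ => by positivity))
  have hsub : ∀ k, ∃ w ∈ regularSubdiff F (z (k + 1)), ‖w‖ ≤ b * ‖z (k + 1) - z k‖ := fun k =>
    exists_regularSubdiff_norm_le hφ hα hρ hL (hfeas k) (hmin k) fun p hp => by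
      rw [hsupp] at hp
      exact ⟨hlow k p hp, hlow (k + 1) p hp⟩
  obtain ⟨x, hx, hcrit⟩ := exists_tendsto_isCriticalPoint_of_isKLFunction
    (continuous_objective hφ f α β γ) hKL (objective_nonneg hφ f hα.le hβ.le hγ.le) hapos hbpos
    hbdd hdec hsub
  exact ⟨x.fst, x.snd, (tendsto_add_atTop_iff_nat K).1 hx, hcrit⟩

end Convergence

end ImageDecomp

end

theorem theorem3 (n : ℕ) [NeZero n] (φ : ℝ → ℝ) (hφ : ImageDecomp.IsPotential φ)
    (f : ImageDecomp.Img n) (α β γ ρ : ℝ) (hα : 0 < α) (hβ : 0 < β) (hγ : 0 < γ) (hρ : 0 < ρ)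
    (hKL : ImageDecomp.IsKLFunction (ImageDecomp.objective φ f α β γ))
    (u v : ℕ → ImageDecomp.Img n)
    (huv : ImageDecomp.IsISSAPLSequence φ f α β γ ρ u v) :
    ∃ ustar vstar : ImageDecomp.Img n,
      Filter.Tendsto (fun k => ImageDecomp.mkPair (u k) (v k)) Filter.atTop
        (nhds (ImageDecomp.mkPair ustar vstar)) ∧
      ImageDecomp.IsCriticalPoint (ImageDecomp.objective φ f α β γ)
        (ImageDecomp.mkPair ustar vstar) :=
  ImageDecomp.IsISSAPLSequence.exists_tendsto_isCriticalPoint φ hφ f α β γ ρ hα hβ hγ hρ hKL u v huv
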